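/- Let $n>0$, $\alpha>0$ and $\Sigma_0>0$ be fixed real numbers. For $\nu>0$ put $c_\nu=1+\nu\,\frac{n+1}{\alpha}$. Then for every $\nu>0$ there exists a solution $(\Sigma,U,\Theta)$, with $U>0$, of the singular system $$\Sigma'=\xi U,\qquad \nu\Big(\frac{n+1}{\alpha}+\xi\Theta'\Big)=\Sigma U-1,\qquad \Sigma=e^{-\alpha\Theta}U^n \qquad (0<\xi<\infty),$$ with $\Sigma(0)=\Sigma_0$, having the following properties. (i) As $\xi\to0^+$, $(\Sigma(\xi),U(\xi),\Theta(\xi))\to(\Sigma_0,U_0,\Theta_0)$, where $U_0$ and $\Theta_0$ are defined by $U_0\Sigma_0=c_\nu$ and $\Theta_0=\frac{n+1}{\alpha}\log U_0-\frac1\alpha\log c_\nu$. (ii) As $\xi\to\infty$, $$U(\xi)=\frac1\xi+o\Big(\frac1\xi\Big),\qquad \Sigma(\xi)=\xi+o(\xi),\qquad \Theta(\xi)=-\frac{n+1}{\alpha}\log\xi+o(1).$$ (iii) $U,\Theta\in C^1[0,\infty)$ and $\Sigma\in C^2[0,\infty)$; the one-sided derivatives at the origin satisfy $\Sigma'(0)=U'(0)=\Theta'(0)=0$;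 and, as $\xi\to0^+$, $$U(\xi)=U_0+o(\xi),\qquad \Sigma(\xi)=\Sigma_0+\tfrac12U_0\xi^2+o(\xi^2),\qquad \Theta(\xi)=\Theta_0+o(\xi).$$ -/

import Mathlib

open Set Filter Topology Asymptotics

namespace ShearBand

/-- `(Sig, U, Th)` is a (classical) solution on the open half-line `0 < ξ < ∞` of the singular system
`Σ' = ξ U`,  `ν ((n+1)/α + ξ Θ') = Σ U - 1`,  `Σ = e^{-α Θ} U ^ n`.
Since the exponent `n` is real, `U` is required to be positive, so that `U ^ n` has its usual
meaning. -/
structure IsSolution (n α ν : ℝ) (Sig U Th : ℝ → ℝ) : Prop where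
  pos_U : ∀ ξ, 0 < ξ → 0 < U ξ
  hasDerivAt_Sig : ∀ ξ, 0 < ξ → HasDerivAt Sig (ξ * U ξ) ξ
  differentiableAt_Th : ∀ ξ, 0 < ξ → DifferentiableAt ℝ Th ξ
  eq_Th : ∀ ξ, 0 < ξ → ν * ((n + 1) / α + ξ * deriv Th ξ) = Sig ξ * U ξ - 1
  eq_Sig : ∀ ξ, 0 < ξ → Sig ξ = Real.exp (-α * Th ξ) * U ξ ^ n

/-- The constant `c_ν = 1 + ν (n+1)/α`. -/
noncomputable def cConst (n α ν : ℝ) : ℝ := 1 + ν * (n + 1) / α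

/-- The initial value `U₀`, determined by `U₀ Σ₀ = c_ν`. -/
noncomputable def U₀ (n α ν Sig₀ : ℝ) : ℝ := cConst n α ν / Sig₀

/-- The initial value `Θ₀ = ((n+1)/α) log U₀ - (1/α) log c_ν`. -/
noncomputable def Th₀ (n α ν Sig₀ : ℝ) : ℝ :=
  (n + 1) / α * Real.log (U₀ n α ν Sig₀) - 1 / α * Real.log (cConst n α ν)

end ShearBand

/-! In s = log ξ the quantities P = ΣU and q = ξ²U/Σ obey an autonomous planar system. With k = α/ν
and y = k(c_ν − P)/(n+1) it reads y' = (kP/n)(y − q), where kP = k + (n+1)(1 − y), and (log q)' =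
(2n − (n+1)y − (n−1)q)/n. The data at ξ = 0 correspond to the rest point (0,0), the behaviour at
infinity to (1,1), so a connecting orbit is needed.

It is found by shooting inside the triangle 0 < q ≤ y ≤ 1. Starting on q = 1/2, the orbit leaves at
once through y = q if y(0) = 1/2, and through y = 1 if y(0) = 1. The two exit conditions are open
and exclude each other, so by connectedness some orbit never leaves (`exists_isOrbit`). On it y and
the Lyapunov function log q + |n−1|y/k are monotone, which forces both limits.

The rates at (0,0) are 2 and 1 + (k+1)/n. Both exceed 1, so y = o(ξ), which gives U'(0) = 0 and the
convergence of log q − 2s. A time translation, that is a rescaling of ξ, adjusts the limit to Σ₀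
(`exists_isLogSolution`). Finally Θ is read off from the algebraic equation. -/

namespace ShearBand

/-! ### Barrier arguments for scalar functions -/

/-- A differentiable function that starts nonpositive and does not increase while it is positive
stays nonpositive. -/
theorem nonpos_of_deriv_nonpos_of_pos {f f' : ℝ → ℝ} {a : ℝ} (hf : ∀ t, HasDerivAt f (f' t) t)
    (ha : f a ≤ 0) (hf' : ∀ t, a ≤ t → 0 < f t → f' t ≤ 0) {b : ℝ} (hab : a ≤ b) : f b ≤ 0 := by
  by_contra! hb
  have hc : Continuous f := continuous_iff_continuousAt.2 fun t => (hf t).continuousAt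
  set S := Icc a b ∩ f ⁻¹' Iic 0 with hS
  have hSc : IsCompact S := isCompact_Icc.inter_right (isClosed_Iic.preimage hc)
  -- Beyond the last point s with f ≤ 0 the function is positive, hence nonincreasing up to b.
  obtain ⟨s, hs, hmax⟩ := hSc.exists_isGreatest ⟨a, ⟨le_rfl, hab⟩, ha⟩
  have hsb : s ≤ b := hs.1.2
  have hpos : ∀ t ∈ Ioo s b, 0 < f t := fun t ht => by
    by_contra! h
    exact absurd (hmax ⟨⟨hs.1.1.trans ht.1.le, ht.2.le⟩, h⟩) (not_le.2 ht.1)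
  have hanti : AntitoneOn f (Icc s b) := by
    refine antitoneOn_of_deriv_nonpos (convex_Icc s b) hc.continuousOn
      (fun t _ => (hf t).differentiableAt.differentiableWithinAt) fun t ht => ?_
    rw [interior_Icc] at ht
    rw [(hf t).deriv]
    exact hf' t (hs.1.1.trans ht.1.le) (hpos t ht)
  have := hanti ⟨le_rfl, hsb⟩ ⟨hsb, le_rfl⟩ hsb
  exact absurd (hb.trans_le (this.trans hs.2)) (lt_irrefl _)

/-- A differentiable function that ends nonpositive and does not decrease while it is positive
was nonpositive before. -/
theorem nonpos_of_deriv_nonneg_of_pos {f f' : ℝ → ℝ} {a : ℝ} (hf : ∀ t, HasDerivAt f (f' t) t)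
    (ha : f a ≤ 0) (hf' : ∀ t, t ≤ a → 0 < f t → 0 ≤ f' t) {b : ℝ} (hab : b ≤ a) : f b ≤ 0 := by
  have := nonpos_of_deriv_nonpos_of_pos (f := fun t => f (-t)) (f' := fun t => -f' (-t)) (a := -a)
    (fun t => by simpa [Function.comp_def] using (hf (-t)).comp t (hasDerivAt_neg t)) (by simpa using ha)
    (fun t ht h => by simpa using hf' (-t) (by linarith) h) (b := -b) (by linarith)
  simpa using this

/-- A differentiable function that starts positive and does not decrease while it is positive
stays positive. -/
theorem pos_of_deriv_nonneg_of_pos {f f' : ℝ → ℝ} {a : ℝ} (hf : ∀ t, HasDerivAt f (f' t) t)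
    (ha : 0 < f a) (hf' : ∀ t, a ≤ t → 0 < f t → 0 ≤ f' t) {b : ℝ} (hab : a ≤ b) : 0 < f b := by
  by_contra! hb
  by_cases h : ∃ t ∈ Icc a b, f t ≤ 0 ∧ ∀ s ∈ Ico a t, 0 < f s
  · obtain ⟨t, ht, hft, hs⟩ := h
    have hmono : MonotoneOn f (Icc a t) := by
      refine monotoneOn_of_deriv_nonneg (convex_Icc a t)
        (fun x _ => (hf x).continuousAt.continuousWithinAt)
        (fun x _ => (hf x).differentiableAt.differentiableWithinAt) fun x hx => ?_
      rw [interior_Icc] at hx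
      rw [(hf x).deriv]
      exact hf' x hx.1.le (hs x ⟨hx.1.le, hx.2⟩)
    have := hmono ⟨le_rfl, ht.1⟩ ⟨ht.1, le_rfl⟩ ht.1
    linarith
  · apply h
    have hc : Continuous f := continuous_iff_continuousAt.2 fun t => (hf t).continuousAt
    have hSc : IsCompact (Icc a b ∩ f ⁻¹' Iic 0) :=
      isCompact_Icc.inter_right (isClosed_Iic.preimage hc)
    obtain ⟨s, hs, hmin⟩ := hSc.exists_isLeast ⟨b, ⟨hab, le_rfl⟩, hb⟩
    refine ⟨s, hs.1, hs.2, fun t ht => ?_⟩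
    by_contra! h'
    exact absurd (hmin ⟨⟨ht.1, ht.2.le.trans hs.1.2⟩, h'⟩) (not_le.2 ht.2)

/-! ### Global flows of bounded Lipschitz fields -/

section Flow

variable {E : Type*} [NormedAddCommGroup E] [NormedSpace ℝ E]

/-- A bounded, globally Lipschitz vector field has global integral curves. -/
theorem exists_global_solution [CompleteSpace E] {f : E → E} {K L : NNReal}
    (hK : LipschitzWith K f) (hL : ∀ x, ‖f x‖ ≤ L) (x : E) :
    ∃ φ : ℝ → E, φ 0 = x ∧ ∀ t, HasDerivAt φ (f (φ t)) t := by
  have hloc : ∀ N : NNReal, ∃ φ : ℝ → E, φ 0 = x ∧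
      ∀ t ∈ Ioo (-(N : ℝ)) N, HasDerivAt φ (f (φ t)) t := by
    intro N
    have h0 : (0 : ℝ) ∈ Icc (-(N : ℝ)) N := by simp
    -- The bound L holds everywhere, so the ball of radius L·N suffices for times up to N, and N is
    -- arbitrary.
    have hPL : IsPicardLindelof (fun _ => f) (⟨0, h0⟩ : Icc (-(N : ℝ)) N) x (L * N) 0 L K :=
      { lipschitzOnWith := fun _ _ => hK.lipschitzOnWith
        continuousOn := fun _ _ => continuousOn_const
        norm_le := fun _ _ y _ => hL y
        mul_max_le := by simp }
    obtain ⟨φ, h1, h2⟩ := hPL.exists_eq_forall_mem_Icc_hasDerivWithinAt₀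
    exact ⟨φ, h1, fun t ht => (h2 t (Ioo_subset_Icc_self ht)).hasDerivAt (Icc_mem_nhds ht.1 ht.2)⟩
  choose φ hφ0 hφ using hloc
  have huniq : ∀ (N M : NNReal) (t : ℝ), |t| < N → N ≤ M → φ N t = φ M t := by
    intro N M t ht hNM
    have hNM' : (N : ℝ) ≤ M := hNM
    refine ODE_solution_unique_of_mem_Ioo (v := fun _ => f) (s := fun _ => univ) (K := K)
      (a := -(N : ℝ)) (b := N) (t₀ := 0) (fun _ _ => hK.lipschitzOnWith) ?_
      (fun s hs => ⟨hφ N s hs, mem_univ _⟩)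
      (fun s hs => ⟨hφ M s ⟨by linarith [hs.1], by linarith [hs.2]⟩, mem_univ _⟩)
      (by rw [hφ0, hφ0]) (abs_lt.1 ht)
    have := (abs_nonneg t).trans_lt ht
    exact ⟨by linarith, this⟩
  -- The curve for |t| + 1 is defined strictly beyond t; by uniqueness the patched function agrees
  -- near t with a single curve.
  let R : ℝ → NNReal := fun t => ⟨|t| + 1, by positivity⟩
  have hR : ∀ t, (R t : ℝ) = |t| + 1 := fun t => rfl
  refine ⟨fun t => φ (R t) t, hφ0 _, fun t => ?_⟩
  have hmem : |t| < (R t : ℝ) := by rw [hR]; linarith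
  refine (hφ (R t) t (abs_lt.1 hmem)).congr_of_eventuallyEq ?_
  have hev : ∀ᶠ s in 𝓝 t, |s| < (R t : ℝ) :=
    continuous_abs.continuousAt.eventually (gt_mem_nhds hmem)
  filter_upwards [hev] with s hs
  rcases le_total (R t) (R s) with h | h
  · exact (huniq _ _ s hs h).symm
  · exact huniq _ _ s (by rw [hR]; linarith) h

/-- Continuous dependence on the initial value for integral curves of a Lipschitz vector field. -/
theorem continuous_flow {f : E → E} {K : NNReal} (hK : LipschitzWith K f) {Φ : E → ℝ → E}
    (h0 : ∀ x, Φ x 0 = x) (hΦ : ∀ x t, HasDerivAt (Φ x) (f (Φ x t)) t) {t : ℝ} (ht : 0 ≤ t) :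
    Continuous fun x => Φ x t := by
  refine LipschitzWith.continuous (K := ⟨Real.exp (K * t), (Real.exp_pos _).le⟩)
    (LipschitzWith.of_dist_le_mul fun x y => ?_)
  have := dist_le_of_trajectories_ODE (v := fun _ => f) (K := K) (a := 0) (b := t)
    (f := Φ x) (g := Φ y) (δ := dist x y) (fun _ => hK)
    (fun s _ => (hΦ x s).continuousAt.continuousWithinAt)
    (fun s _ => (hΦ x s).hasDerivWithinAt)
    (fun s _ => (hΦ y s).continuousAt.continuousWithinAt)
    (fun s _ => (hΦ y s).hasDerivWithinAt) (by rw [h0, h0]) t ⟨ht, le_rfl⟩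
  rw [sub_zero, mul_comm] at this
  exact this

end Flow

/-! ### The truncated planar field -/

/-- Projection to the unit interval. -/
noncomputable def clampY (y : ℝ) : ℝ := max 0 (min y 1)

/-- The exponential, cut off at the value one. -/
noncomputable def clampQ (w : ℝ) : ℝ := Real.exp (min w 0)

theorem clampY_nonneg (y : ℝ) : 0 ≤ clampY y := le_max_left _ _

theorem clampY_le_one (y : ℝ) : clampY y ≤ 1 := max_le zero_le_one (min_le_right _ _)

theorem clampQ_nonneg (w : ℝ) : 0 ≤ clampQ w := (Real.exp_pos _).le

theorem clampQ_le_one (w : ℝ) : clampQ w ≤ 1 := Real.exp_le_one_iff.2 (min_le_right _ _)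

theorem clampY_of_mem {y : ℝ} (h0 : 0 ≤ y) (h1 : y ≤ 1) : clampY y = y := by
  rw [clampY, min_eq_left h1, max_eq_right h0]

theorem clampY_of_one_le {y : ℝ} (h1 : 1 ≤ y) : clampY y = 1 := by
  rw [clampY, min_eq_right h1, max_eq_right zero_le_one]

theorem clampQ_of_nonpos {w : ℝ} (h : w ≤ 0) : clampQ w = Real.exp w := by
  rw [clampQ, min_eq_left h]

theorem clampQ_of_nonneg {w : ℝ} (h : 0 ≤ w) : clampQ w = 1 := by
  rw [clampQ, min_eq_right h, Real.exp_zero]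

/-- Truncation respects the inequality y ≤ q, so sign arguments on that side of the diagonal carry
over to the truncated field. -/
theorem clampY_le_clampQ {y w : ℝ} (h : y ≤ Real.exp w) : clampY y ≤ clampQ w := by
  rcases le_total w 0 with hw | hw
  · rw [clampQ_of_nonpos hw]
    exact max_le (Real.exp_pos _).le ((min_le_left _ _).trans h)
  · rw [clampQ_of_nonneg hw]
    exact clampY_le_one y

theorem lipschitzWith_clampY : LipschitzWith 1 clampY :=
  (LipschitzWith.id.min_const 1).const_max 0

theorem abs_exp_sub_exp_le {a b : ℝ} (ha : a ≤ 0) (hb : b ≤ 0) :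
    |Real.exp a - Real.exp b| ≤ |a - b| := by
  wlog h : b ≤ a generalizing a b
  · rw [abs_sub_comm, abs_sub_comm a b]
    exact this hb ha (le_of_not_ge h)
  rw [abs_of_nonneg (sub_nonneg.2 (Real.exp_le_exp.2 h)), abs_of_nonneg (sub_nonneg.2 h)]
  have h1 : Real.exp b = Real.exp a * Real.exp (b - a) := by
    rw [← Real.exp_add]; congr 1; ring
  have h2 := Real.add_one_le_exp (b - a)
  have h3 : Real.exp a ≤ 1 := Real.exp_le_one_iff.2 ha
  have h4 := Real.exp_pos a
  rw [h1]
  nlinarith [sub_nonneg.2 h]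

theorem lipschitzWith_clampQ : LipschitzWith 1 clampQ := by
  have h1 : LipschitzWith 1 fun w : ℝ => min w 0 := LipschitzWith.id.min_const 0
  refine LipschitzWith.of_dist_le_mul fun a b => ?_
  refine le_trans ?_ (h1.dist_le_mul a b)
  rw [Real.dist_eq, Real.dist_eq]
  exact abs_exp_sub_exp_le (min_le_right _ _) (min_le_right _ _)

/-- The reduced planar vector field, in the variables `(y, q)`; its second component is the
logarithmic derivative of `q`. -/
noncomputable def planarField (n k : ℝ) (z : ℝ × ℝ) : ℝ × ℝ :=
  ((k + (n + 1) * (1 - z.1)) / n * (z.1 - z.2), (2 * n - (n + 1) * z.1 - (n - 1) * z.2) / n)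

/-- The reduced vector field in the variables `(y, log q)`, truncated outside the unit square. -/
noncomputable def truncField (n k : ℝ) (z : ℝ × ℝ) : ℝ × ℝ :=
  planarField n k (clampY z.1, clampQ z.2)

theorem contDiff_planarField (n k : ℝ) : ContDiff ℝ 1 (planarField n k) := by
  unfold planarField
  fun_prop

theorem exists_lipschitzWith_truncField (n k : ℝ) :
    ∃ K L : NNReal, LipschitzWith K (truncField n k) ∧ ∀ x, ‖truncField n k x‖ ≤ L := by
  have hcomp : IsCompact (Icc (0 : ℝ) 1 ×ˢ Icc (0 : ℝ) 1) := isCompact_Icc.prod isCompact_Icc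
  have hG := contDiff_planarField n k
  obtain ⟨K, hK⟩ := LocallyLipschitzOn.exists_lipschitzOnWith_of_compact hcomp
    (hG.locallyLipschitz.locallyLipschitzOn (s := Icc (0 : ℝ) 1 ×ˢ Icc (0 : ℝ) 1))
  obtain ⟨L, hL⟩ := hcomp.exists_bound_of_continuousOn hG.continuous.continuousOn
  have hmem : ∀ z : ℝ × ℝ, (clampY z.1, clampQ z.2) ∈ Icc (0 : ℝ) 1 ×ˢ Icc (0 : ℝ) 1 := fun z =>
    ⟨⟨clampY_nonneg _, clampY_le_one _⟩, ⟨clampQ_nonneg _, clampQ_le_one _⟩⟩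
  have hc : LipschitzWith 1 fun z : ℝ × ℝ => (clampY z.1, clampQ z.2) := by
    simpa using (lipschitzWith_clampY.comp LipschitzWith.prod_fst).prodMk
      (lipschitzWith_clampQ.comp LipschitzWith.prod_snd)
  refine ⟨K, L.toNNReal, LipschitzWith.of_dist_le_mul fun x y => ?_, fun x => ?_⟩
  · refine (hK.dist_le_mul _ (hmem x) _ (hmem y)).trans ?_
    gcongr
    simpa using hc.dist_le_mul x y
  · exact (hL _ (hmem x)).trans (Real.le_coe_toNNReal L)

/-! ### Shooting for an orbit that stays in the triangle -/

section Shooting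

variable {n k : ℝ}

theorem truncField_fst_nonpos (hn : 0 < n) (hk : 0 < k) {z : ℝ × ℝ} (h : z.1 ≤ Real.exp z.2) :
    (truncField n k z).1 ≤ 0 := by
  have h1 := clampY_le_clampQ h
  have h2 := clampY_le_one z.1
  have : 0 ≤ (n + 1) * (1 - clampY z.1) := mul_nonneg (by linarith) (by linarith)
  exact mul_nonpos_of_nonneg_of_nonpos (div_nonneg (by linarith) hn.le) (by simpa using h1)

theorem truncField_snd_nonneg (hn : 0 < n) {z : ℝ × ℝ} (h : z.1 ≤ Real.exp z.2) :
    0 ≤ (truncField n k z).2 := by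
  have h1 := clampY_le_clampQ h
  have h2 := clampQ_le_one z.2
  refine div_nonneg ?_ hn.le
  change 0 ≤ 2 * n - (n + 1) * clampY z.1 - (n - 1) * clampQ z.2
  -- Since y ≤ q ≤ 1 after truncation, the numerator is at least 2n(1 − q).
  nlinarith

theorem truncField_fst_nonneg_of_one_le (hn : 0 < n) (hk : 0 < k) {z : ℝ × ℝ} (h : 1 ≤ z.1) :
    0 ≤ (truncField n k z).1 := by
  have h1 := clampQ_le_one z.2
  have h2 := clampY_of_one_le h
  refine mul_nonneg (div_nonneg ?_ hn.le) ?_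
  · change 0 ≤ k + (n + 1) * (1 - clampY z.1)
    rw [h2]; linarith
  · change 0 ≤ clampY z.1 - clampQ z.2
    rw [h2]; linarith

/-- Both truncations saturate at the rest point (1,1). This keeps log q from becoming positive at
that corner. -/
theorem truncField_snd_eq_zero {z : ℝ × ℝ} (h : 1 ≤ z.1) (h' : 0 ≤ z.2) :
    (truncField n k z).2 = 0 := by
  change (2 * n - (n + 1) * clampY z.1 - (n - 1) * clampQ z.2) / n = 0
  rw [clampY_of_one_le h, clampQ_of_nonneg h']
  ring_nf

variable {φ : ℝ → ℝ × ℝ}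

theorem hasDerivAt_fst_orbit (hφ : ∀ t, HasDerivAt φ (truncField n k (φ t)) t) (t : ℝ) :
    HasDerivAt (fun t => (φ t).1) (truncField n k (φ t)).1 t :=
  (hasFDerivAt_fst (𝕜 := ℝ) (p := φ t)).comp_hasDerivAt t (hφ t)

theorem hasDerivAt_snd_orbit (hφ : ∀ t, HasDerivAt φ (truncField n k (φ t)) t) (t : ℝ) :
    HasDerivAt (fun t => (φ t).2) (truncField n k (φ t)).2 t :=
  (hasFDerivAt_snd (𝕜 := ℝ) (p := φ t)).comp_hasDerivAt t (hφ t)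

theorem hasDerivAt_gap_orbit (hφ : ∀ t, HasDerivAt φ (truncField n k (φ t)) t) (t : ℝ) :
    HasDerivAt (fun t => Real.exp (φ t).2 - (φ t).1)
      (Real.exp (φ t).2 * (truncField n k (φ t)).2 - (truncField n k (φ t)).1) t :=
  ((hasDerivAt_snd_orbit hφ t).exp).sub (hasDerivAt_fst_orbit hφ t)

/-- Where q > y, y does not increase and q does not decrease, so an orbit that has crossed the
diagonal never returns. -/
theorem gap_deriv_nonneg (hn : 0 < n) (hk : 0 < k) {z : ℝ × ℝ} (h : 0 < Real.exp z.2 - z.1) :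
    0 ≤ Real.exp z.2 * (truncField n k z).2 - (truncField n k z).1 := by
  have h1 := truncField_fst_nonpos hn hk (z := z) (by linarith)
  have h2 := truncField_snd_nonneg (k := k) hn (z := z) (by linarith)
  have := mul_nonneg (Real.exp_pos z.2).le h2
  linarith

/-- An orbit cannot leave the triangle through both of its non-invariant sides. -/
theorem orbit_exits_disjoint (hn : 0 < n) (hk : 0 < k)
    (hφ : ∀ t, HasDerivAt φ (truncField n k (φ t)) t) {t₁ t₂ : ℝ}
    (h₁ : (φ t₁).1 < Real.exp (φ t₁).2) (h₁' : (φ t₁).1 < 1) (h₂ : 1 < (φ t₂).1) : False := by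
  have hgap : ∀ t, t₁ ≤ t → 0 < Real.exp (φ t).2 - (φ t).1 := fun t ht =>
    pos_of_deriv_nonneg_of_pos (hasDerivAt_gap_orbit hφ) (sub_pos.2 h₁)
      (fun s _ h => gap_deriv_nonneg hn hk h) ht
  have ha : (φ (max t₁ t₂)).1 - (φ t₁).1 ≤ 0 :=
    nonpos_of_deriv_nonpos_of_pos (f := fun t => (φ t).1 - (φ t₁).1)
      (fun t => (hasDerivAt_fst_orbit hφ t).sub_const _) (a := t₁) (by simp)
      (fun t ht _ => truncField_fst_nonpos hn hk (by linarith [hgap t ht])) (le_max_left _ _)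
  have hb : 0 < (φ (max t₁ t₂)).1 - 1 :=
    pos_of_deriv_nonneg_of_pos (f := fun t => (φ t).1 - 1)
      (fun t => (hasDerivAt_fst_orbit hφ t).sub_const _) (a := t₂) (by simpa using h₂)
      (fun t _ h => truncField_fst_nonneg_of_one_le hn hk (by linarith)) (le_max_right _ _)
  linarith

/-- An orbit that starts in the triangle and leaves it through neither side stays there for all
times, past and future. -/
theorem orbit_mem_triangle (hn : 0 < n) (hk : 0 < k)
    (hφ : ∀ t, HasDerivAt φ (truncField n k (φ t)) t) (hw : (φ 0).2 ≤ 0)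
    (h0 : Real.exp (φ 0).2 ≤ (φ 0).1)
    (hA : ∀ t, 0 ≤ t → (φ t).1 < Real.exp (φ t).2 → 1 ≤ (φ t).1)
    (hB : ∀ t, 0 ≤ t → (φ t).1 ≤ 1) (t : ℝ) : Real.exp (φ t).2 ≤ (φ t).1 ∧ (φ t).1 ≤ 1 := by
  rcases le_total 0 t with ht | ht
  · refine ⟨?_, hB t ht⟩
    -- If log q > 0 then q > 1 ≥ y, and `hA` forces y = 1, where log q is stationary.
    have hw' : (φ t).2 ≤ 0 := by
      refine nonpos_of_deriv_nonpos_of_pos (hasDerivAt_snd_orbit hφ) hw (fun s hs h => ?_) ht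
      have h1 : 1 < Real.exp (φ s).2 := Real.one_lt_exp_iff.2 h
      exact (truncField_snd_eq_zero (hA s hs ((hB s hs).trans_lt h1)) h.le).le
    by_contra! h
    have := hA t ht h
    have := Real.exp_le_one_iff.2 hw'
    linarith
  · constructor
    · have := nonpos_of_deriv_nonneg_of_pos (hasDerivAt_gap_orbit hφ) (sub_nonpos.2 h0)
        (fun s _ h => gap_deriv_nonneg hn hk h) ht
      linarith
    · have := nonpos_of_deriv_nonneg_of_pos (f := fun t => (φ t).1 - 1)
        (fun t => (hasDerivAt_fst_orbit hφ t).sub_const _) (a := 0) (by simpa using hB 0 le_rfl)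
        (fun s _ h => truncField_fst_nonneg_of_one_le hn hk (by linarith)) ht
      linarith

/-- Produces an exit time for an orbit starting on a side with outward speed, while an open side
condition `P` persists. -/
theorem exists_pos_of_deriv_pos {f : ℝ → ℝ} {f' : ℝ} (hf : HasDerivAt f f' 0) (h0 : 0 ≤ f 0)
    (hf' : 0 < f') {P : ℝ → Prop} (hP : ∀ᶠ t in 𝓝 0, P t) : ∃ t, 0 ≤ t ∧ 0 < f t ∧ P t := by
  have h := (hasDerivAt_iff_tendsto_slope.1 hf).eventually (lt_mem_nhds hf')
  have h1 : ∀ᶠ t in 𝓝[>] (0 : ℝ), 0 < slope f 0 t :=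
    h.filter_mono (nhdsWithin_mono _ fun x hx => ne_of_gt hx)
  obtain ⟨t, ⟨ht, hPt⟩, ht0⟩ :=
    ((h1.and (hP.filter_mono nhdsWithin_le_nhds)).and self_mem_nhdsWithin).exists
  have ht0' : (0 : ℝ) < t := ht0
  refine ⟨t, ht0'.le, ?_, hPt⟩
  rw [slope_def_field, sub_zero, div_pos_iff_of_pos_right ht0'] at ht
  linarith

/-- A complete orbit `(y, log q)` of the reduced system in the triangle `0 < q ≤ y ≤ 1`. -/
structure IsOrbit (n k : ℝ) (y w : ℝ → ℝ) : Prop where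
  hasDerivAt_y : ∀ t, HasDerivAt y ((k + (n + 1) * (1 - y t)) / n * (y t - Real.exp (w t))) t
  hasDerivAt_w : ∀ t, HasDerivAt w ((2 * n - (n + 1) * y t - (n - 1) * Real.exp (w t)) / n) t
  exp_le : ∀ t, Real.exp (w t) ≤ y t
  le_one : ∀ t, y t ≤ 1
  zero_lt_one : y 0 < 1

theorem exists_isOrbit (hn : 0 < n) (hk : 0 < k) : ∃ y w : ℝ → ℝ, IsOrbit n k y w := by
  obtain ⟨K, L, hK, hL⟩ := exists_lipschitzWith_truncField n k
  choose Φ hΦ0 hΦ using exists_global_solution hK hL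
  have hcont : ∀ t, 0 ≤ t → Continuous fun a : ℝ => Φ (a, Real.log (1 / 2)) t := fun t ht =>
    (continuous_flow hK hΦ0 hΦ ht).comp (by fun_prop)
  set Ψ : ℝ → ℝ → ℝ × ℝ := fun a => Φ (a, Real.log (1 / 2)) with hΨ
  have hΨd : ∀ a t, HasDerivAt (Ψ a) (truncField n k (Ψ a t)) t := fun a => hΦ _
  have hΨ0 : ∀ a, Ψ a 0 = (a, Real.log (1 / 2)) := fun a => hΦ0 _
  have hlog : Real.log (1 / 2) ≤ 0 := Real.log_nonpos (by norm_num) (by norm_num)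
  have hexp : Real.exp (Real.log (1 / 2)) = 1 / 2 := Real.exp_log (by norm_num)
  have hcq : clampQ (Real.log (1 / 2)) = 1 / 2 := by rw [clampQ_of_nonpos hlog, hexp]
  -- Initial values whose orbit leaves through y = q or through y = 1. The clause y < 1 in `A` makes
  -- the two sets disjoint: beyond y = 1 an orbit could satisfy y < q as well.
  set A : Set ℝ := ⋃ t ∈ Ici (0 : ℝ), {a | (Ψ a t).1 < Real.exp (Ψ a t).2 ∧ (Ψ a t).1 < 1} with hA
  set B : Set ℝ := ⋃ t ∈ Ici (0 : ℝ), {a | 1 < (Ψ a t).1} with hB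
  have hAo : IsOpen A := isOpen_biUnion fun t ht =>
    (isOpen_lt (hcont t ht).fst (Real.continuous_exp.comp (hcont t ht).snd)).inter
      (isOpen_lt (hcont t ht).fst continuous_const)
  have hBo : IsOpen B := isOpen_biUnion fun t ht => isOpen_lt continuous_const (hcont t ht).fst
  have hAB : ∀ a, a ∈ A → a ∈ B → False := by
    intro a ha hb
    simp only [hA, hB, mem_iUnion, mem_ofPred_eq, exists_prop] at ha hb
    obtain ⟨t₁, -, h₁, h₁'⟩ := ha
    obtain ⟨t₂, -, h₂⟩ := hb
    exact orbit_exits_disjoint hn hk (hΨd a) h₁ h₁' h₂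
  -- On the diagonal y' = 0, while q' = q = 1/2 > 0, so q − y becomes positive.
  have hAne : (1 / 2 : ℝ) ∈ A := by
    have hd := hasDerivAt_gap_orbit (hΨd (1 / 2)) 0
    have hval : truncField n k (1 / 2, Real.log (1 / 2)) = (0, 1) := by
      simp only [truncField, hcq, clampY_of_mem (y := 1 / 2) (by norm_num) (by norm_num),
        planarField, Prod.mk.injEq]
      constructor
      · ring
      · field_simp; ring
    rw [hΨ0, hval] at hd
    obtain ⟨t, ht, h1, h2⟩ := exists_pos_of_deriv_pos hd (by simp only [hΨ0, hexp, sub_self, le_refl])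
      (by simp only [hexp]; norm_num)
      (P := fun t => (Ψ (1 / 2) t).1 < 1)
      ((hasDerivAt_fst_orbit (hΨd (1 / 2)) 0).continuousAt.eventually
        (gt_mem_nhds (by simp only [hΨ0]; norm_num)))
    simp only [hA, mem_iUnion, mem_ofPred_eq, exists_prop]
    exact ⟨t, ht, by linarith, h2⟩
  -- Here y' = k/(2n) > 0 at y = 1.
  have hBne : (1 : ℝ) ∈ B := by
    have hd := (hasDerivAt_fst_orbit (hΨd 1) 0).sub_const 1
    have hval : (truncField n k (1, Real.log (1 / 2))).1 = k / n * (1 / 2) := by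
      simp only [truncField, hcq, clampY_of_one_le (le_refl (1 : ℝ)), planarField]
      ring
    rw [hΨ0, hval] at hd
    obtain ⟨t, ht, h1, -⟩ := exists_pos_of_deriv_pos hd (by simp [hΨ0]) (by positivity)
      (P := fun _ => True) (by simp)
    simp only [hB, mem_iUnion, mem_ofPred_eq, exists_prop]
    exact ⟨t, ht, by linarith⟩
  have hex : ∃ a ∈ Icc (1 / 2 : ℝ) 1, a ∉ A ∧ a ∉ B := by
    by_contra! h
    obtain ⟨a, -, ha, hb⟩ := (isPreconnected_Icc (a := (1 / 2 : ℝ)) (b := 1)) A B hAo hBo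
      (fun a ha => by
        by_cases haA : a ∈ A
        · exact Or.inl haA
        · exact Or.inr (h a ha haA))
      ⟨1 / 2, ⟨le_rfl, by norm_num⟩, hAne⟩ ⟨1, ⟨by norm_num, le_rfl⟩, hBne⟩
    exact hAB a ha hb
  obtain ⟨a, ha, haA, haB⟩ := hex
  have ha1 : a < 1 := lt_of_le_of_ne ha.2 fun h => haB (h ▸ hBne)
  simp only [hA, hB, mem_iUnion, mem_ofPred_eq, exists_prop, not_exists, not_and, not_lt]
    at haA haB
  have htri := orbit_mem_triangle hn hk (hΨd a) (by rw [hΨ0]; exact hlog)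
    (by rw [hΨ0, hexp]; exact ha.1) haA haB
  have hval : ∀ t, truncField n k (Ψ a t) = planarField n k ((Ψ a t).1, Real.exp (Ψ a t).2) := by
    intro t
    obtain ⟨h1, h2⟩ := htri t
    rw [truncField, clampY_of_mem ((Real.exp_pos _).le.trans h1) h2,
      clampQ_of_nonpos (Real.exp_le_one_iff.1 (h1.trans h2))]
  refine ⟨fun t => (Ψ a t).1, fun t => (Ψ a t).2, fun t => ?_, fun t => ?_,
    fun t => (htri t).1, fun t => (htri t).2, by simpa [hΨ0] using ha1⟩
  · simpa [hval, planarField] using hasDerivAt_fst_orbit (hΨd a) t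
  · simpa [hval, planarField] using hasDerivAt_snd_orbit (hΨd a) t

end Shooting

/-! ### Limits and decay rates of the connecting orbit -/

theorem mul_sub_le_of_le_deriv {f f' : ℝ → ℝ} (hf : ∀ t, HasDerivAt f (f' t) t) {a b δ : ℝ}
    (hab : a ≤ b) (h : ∀ t ∈ Icc a b, δ ≤ f' t) : δ * (b - a) ≤ f b - f a := by
  refine (convex_Icc a b).mul_sub_le_image_sub_of_le_deriv
    (fun t _ => (hf t).continuousAt.continuousWithinAt)
    (fun t _ => (hf t).differentiableAt.differentiableWithinAt) (fun t ht => ?_)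
    a ⟨le_rfl, hab⟩ b ⟨hab, le_rfl⟩ hab
  rw [(hf t).deriv]
  exact h t (interior_subset ht)

theorem exists_lt_of_le_deriv {f f' : ℝ → ℝ} (hf : ∀ t, HasDerivAt f (f' t) t) {a δ : ℝ}
    (hδ : 0 < δ) (h : ∀ t, a ≤ t → δ ≤ f' t) (C : ℝ) : ∃ t, C < f t := by
  by_contra! hC
  have h1 : 0 ≤ (C - f a + 1) / δ := div_nonneg (by linarith [hC a]) hδ.le
  have h2 := mul_sub_le_of_le_deriv hf (a := a) (b := a + (C - f a + 1) / δ) (by linarith)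
    fun t ht => h t ht.1
  rw [add_sub_cancel_left, mul_div_cancel₀ _ hδ.ne'] at h2
  linarith [hC (a + (C - f a + 1) / δ)]

theorem exists_gt_of_le_deriv {f f' : ℝ → ℝ} (hf : ∀ t, HasDerivAt f (f' t) t) {a δ : ℝ}
    (hδ : 0 < δ) (h : ∀ t, t ≤ a → δ ≤ f' t) (C : ℝ) : ∃ t, f t < C := by
  by_contra! hC
  have h1 : 0 ≤ (f a - C + 1) / δ := div_nonneg (by linarith [hC a]) hδ.le
  have h2 := mul_sub_le_of_le_deriv hf (a := a - (f a - C + 1) / δ) (b := a) (by linarith)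
    fun t ht => h t ht.2
  rw [sub_sub_cancel, mul_div_cancel₀ _ hδ.ne'] at h2
  linarith [hC (a - (f a - C + 1) / δ)]

theorem exists_tendsto_atTop_of_monotone {f : ℝ → ℝ} (hf : Monotone f) {C : ℝ} (h : ∀ t, f t ≤ C) :
    ∃ l, Tendsto f atTop (𝓝 l) :=
  ⟨_, tendsto_atTop_ciSup hf ⟨C, by rintro _ ⟨t, rfl⟩; exact h t⟩⟩

theorem exists_tendsto_atBot_of_monotone {f : ℝ → ℝ} (hf : Monotone f) {C : ℝ} (h : ∀ t, C ≤ f t) :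
    ∃ l, Tendsto f atBot (𝓝 l) :=
  ⟨_, tendsto_atBot_ciInf hf ⟨C, by rintro _ ⟨t, rfl⟩; exact h t⟩⟩

namespace IsOrbit

variable {n k : ℝ} {y w : ℝ → ℝ}

theorem y_pos (h : IsOrbit n k y w) (t : ℝ) : 0 < y t := (Real.exp_pos _).trans_le (h.exp_le t)

theorem w_nonpos (h : IsOrbit n k y w) (t : ℝ) : w t ≤ 0 :=
  Real.exp_le_one_iff.1 ((h.exp_le t).trans (h.le_one t))

theorem continuous_y (h : IsOrbit n k y w) : Continuous y :=
  continuous_iff_continuousAt.2 fun t => (h.hasDerivAt_y t).continuousAt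

theorem continuous_w (h : IsOrbit n k y w) : Continuous w :=
  continuous_iff_continuousAt.2 fun t => (h.hasDerivAt_w t).continuousAt

theorem le_deriv_y (h : IsOrbit n k y w) (hn : 0 < n) (t : ℝ) :
    k / n * (y t - Real.exp (w t)) ≤ (k + (n + 1) * (1 - y t)) / n * (y t - Real.exp (w t)) := by
  have h1 := h.exp_le t
  have h2 := h.le_one t
  refine mul_le_mul_of_nonneg_right ?_ (by linarith)
  gcongr
  nlinarith

theorem monotone_y (h : IsOrbit n k y w) (hn : 0 < n) (hk : 0 < k) : Monotone y := by
  refine monotone_of_deriv_nonneg (fun t => (h.hasDerivAt_y t).differentiableAt) fun t => ?_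
  rw [(h.hasDerivAt_y t).deriv]
  exact (mul_nonneg (by positivity) (sub_nonneg.2 (h.exp_le t))).trans (h.le_deriv_y hn t)

theorem hasDerivAt_lyapunov (h : IsOrbit n k y w) (t : ℝ) :
    HasDerivAt (fun t => w t + |n - 1| / k * y t)
      ((2 * n - (n + 1) * y t - (n - 1) * Real.exp (w t)) / n +
        |n - 1| / k * ((k + (n + 1) * (1 - y t)) / n * (y t - Real.exp (w t)))) t :=
  (h.hasDerivAt_w t).add ((h.hasDerivAt_y t).const_mul _)

/-- One has w' = 2(1 − y) + (n−1)(y − q)/n. The last term has no fixed sign; y' ≥ (k/n)(y − q),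
weighted by |n−1|/k, compensates it. -/
theorem le_deriv_lyapunov (h : IsOrbit n k y w) (hn : 0 < n) (hk : 0 < k) (t : ℝ) :
    2 * (1 - y t) ≤ (2 * n - (n + 1) * y t - (n - 1) * Real.exp (w t)) / n +
        |n - 1| / k * ((k + (n + 1) * (1 - y t)) / n * (y t - Real.exp (w t))) := by
  have h1 : |n - 1| / k * (k / n * (y t - Real.exp (w t))) ≤
      |n - 1| / k * ((k + (n + 1) * (1 - y t)) / n * (y t - Real.exp (w t))) :=
    mul_le_mul_of_nonneg_left (h.le_deriv_y hn t) (by positivity)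
  have h2 : |n - 1| / k * (k / n * (y t - Real.exp (w t))) =
      |n - 1| * (y t - Real.exp (w t)) / n := by field_simp
  have h3 : (2 * n - (n + 1) * y t - (n - 1) * Real.exp (w t)) / n =
      2 * (1 - y t) + (n - 1) * (y t - Real.exp (w t)) / n := by field_simp; ring
  have h4 : 0 ≤ (n - 1) * (y t - Real.exp (w t)) / n + |n - 1| * (y t - Real.exp (w t)) / n := by
    rw [← add_div, ← add_mul]
    refine div_nonneg (mul_nonneg ?_ (sub_nonneg.2 (h.exp_le t))) hn.le
    linarith [neg_abs_le (n - 1)]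
  linarith

theorem monotone_lyapunov (h : IsOrbit n k y w) (hn : 0 < n) (hk : 0 < k) :
    Monotone fun t => w t + |n - 1| / k * y t := by
  refine monotone_of_deriv_nonneg (fun t => (h.hasDerivAt_lyapunov t).differentiableAt) fun t => ?_
  rw [(h.hasDerivAt_lyapunov t).deriv]
  linarith [h.le_deriv_lyapunov hn hk t, h.le_one t]

theorem lyapunov_le (h : IsOrbit n k y w) (hk : 0 < k) (t : ℝ) :
    w t + |n - 1| / k * y t ≤ |n - 1| / k := by
  have h1 : |n - 1| / k * y t ≤ |n - 1| / k * 1 :=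
    mul_le_mul_of_nonneg_left (h.le_one t) (by positivity)
  linarith [h.w_nonpos t]

/-- A limit below 1 would make the Lyapunov function grow linearly, but it is bounded above. -/
theorem tendsto_y_atTop (h : IsOrbit n k y w) (hn : 0 < n) (hk : 0 < k) :
    Tendsto y atTop (𝓝 1) := by
  obtain ⟨l, hl⟩ := exists_tendsto_atTop_of_monotone (h.monotone_y hn hk) h.le_one
  have hle : ∀ t, y t ≤ l := (h.monotone_y hn hk).ge_of_tendsto hl
  have hl1 : l ≤ 1 := le_of_tendsto' hl h.le_one
  rcases hl1.eq_or_lt with rfl | hlt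
  · exact hl
  · obtain ⟨t, ht⟩ := exists_lt_of_le_deriv h.hasDerivAt_lyapunov (a := 0) (δ := 2 * (1 - l))
      (by linarith) (fun t _ => by linarith [h.le_deriv_lyapunov hn hk t, hle t]) (|n - 1| / k)
    exact absurd ht (not_lt.2 (h.lyapunov_le hk t))

/-- Convergence follows from that of y and the Lyapunov function; a negative limit would keep y'
bounded below by a positive constant, against y ≤ 1. -/
theorem tendsto_w_atTop (h : IsOrbit n k y w) (hn : 0 < n) (hk : 0 < k) :
    Tendsto w atTop (𝓝 0) := by
  obtain ⟨l, hl⟩ := exists_tendsto_atTop_of_monotone (h.monotone_lyapunov hn hk) (h.lyapunov_le hk)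
  have hy := h.tendsto_y_atTop hn hk
  have hw : Tendsto w atTop (𝓝 (l - |n - 1| / k * 1)) := by
    simpa using hl.sub (hy.const_mul (|n - 1| / k))
  set m := l - |n - 1| / k * 1
  have hm : m ≤ 0 := le_of_tendsto' hw h.w_nonpos
  rcases hm.eq_or_lt with h0 | hlt
  · rwa [h0] at hw
  · have hd : Tendsto (fun t => y t - Real.exp (w t)) atTop (𝓝 (1 - Real.exp m)) :=
      hy.sub ((Real.continuous_exp.tendsto m).comp hw)
    have hpos : 0 < 1 - Real.exp m := sub_pos.2 (Real.exp_lt_one_iff.2 hlt)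
    obtain ⟨a, ha⟩ := eventually_atTop.1 (hd.eventually (lt_mem_nhds (half_lt_self hpos)))
    obtain ⟨t, ht⟩ := exists_lt_of_le_deriv h.hasDerivAt_y (a := a)
      (δ := k / n * ((1 - Real.exp m) / 2)) (by positivity)
      (fun t ht => (mul_le_mul_of_nonneg_left (ha t ht).le (by positivity)).trans
        (h.le_deriv_y hn t)) 1
    exact absurd ht (not_lt.2 (h.le_one t))

/-- For t ≤ 0 monotonicity gives 1 − y ≥ 1 − y(0) > 0, so the Lyapunov function falls at least
linearly backward in time. -/
theorem tendsto_w_atBot (h : IsOrbit n k y w) (hn : 0 < n) (hk : 0 < k) :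
    Tendsto w atBot atBot := by
  have hδ : 0 < 2 * (1 - y 0) := by linarith [h.zero_lt_one]
  have hlin : Tendsto (fun t : ℝ => w 0 + |n - 1| / k * y 0 + 2 * (1 - y 0) * t) atBot atBot :=
    tendsto_atBot_add_const_left _ _ (tendsto_id.const_mul_atBot hδ)
  refine tendsto_atBot_mono' _ ?_ hlin
  filter_upwards [eventually_le_atBot (0 : ℝ)] with t ht
  have h1 := mul_sub_le_of_le_deriv h.hasDerivAt_lyapunov (a := t) (b := 0) (δ := 2 * (1 - y 0)) ht
    fun s hs => by linarith [h.le_deriv_lyapunov hn hk s, h.monotone_y hn hk hs.2]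
  have h2 : 0 ≤ |n - 1| / k * y t := mul_nonneg (by positivity) (h.y_pos t).le
  linarith

theorem tendsto_exp_w_atBot (h : IsOrbit n k y w) (hn : 0 < n) (hk : 0 < k) :
    Tendsto (fun t => Real.exp (w t)) atBot (𝓝 0) :=
  Real.tendsto_exp_atBot.comp (h.tendsto_w_atBot hn hk)

theorem tendsto_y_atBot (h : IsOrbit n k y w) (hn : 0 < n) (hk : 0 < k) :
    Tendsto y atBot (𝓝 0) := by
  obtain ⟨l, hl⟩ := exists_tendsto_atBot_of_monotone (h.monotone_y hn hk) fun t => (h.y_pos t).le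
  have hle : ∀ t, l ≤ y t := (h.monotone_y hn hk).le_of_tendsto hl
  have hl0 : 0 ≤ l := ge_of_tendsto' hl fun t => (h.y_pos t).le
  rcases hl0.eq_or_lt with rfl | hlt
  · exact hl
  · obtain ⟨a, ha⟩ := eventually_atBot.1
      ((h.tendsto_exp_w_atBot hn hk).eventually (gt_mem_nhds (half_pos hlt)))
    obtain ⟨t, ht⟩ := exists_gt_of_le_deriv h.hasDerivAt_y (a := a) (δ := k / n * (l / 2))
      (by positivity)
      (fun t ht => (mul_le_mul_of_nonneg_left (by linarith [ha t ht, hle t])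
        (by positivity)).trans (h.le_deriv_y hn t)) 0
    exact absurd ht (not_lt.2 (h.y_pos t).le)

/-- Along the unstable node at the origin, orbits decay faster than `e^t`. -/
theorem exists_y_le_exp (h : IsOrbit n k y w) (hn : 0 < n) (hk : 0 < k) :
    ∃ δ C a : ℝ, 0 < δ ∧ ∀ t, t ≤ a → y t ≤ C * Real.exp ((1 + δ) * t) := by
  have hy := h.tendsto_y_atBot hn hk
  have hq := h.tendsto_exp_w_atBot hn hk
  -- The rate 1 + δ must lie below 1 + (k+1)/n and, with the margin 1/4 used below, below 7/4 < 2.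
  obtain ⟨δ, hδ0, hδ1, hδ2⟩ : ∃ δ : ℝ, 0 < δ ∧ δ ≤ 1 / 2 ∧ δ < (k + 1) / n :=
    ⟨min (1 / 2) ((k + 1) / (2 * n)), by positivity, min_le_left _ _,
      (min_le_right _ _).trans_lt (by
        rw [div_lt_div_iff_of_pos_left (by positivity) (by positivity) hn]; linarith)⟩
  have hA : Tendsto (fun t => (k + (n + 1) * (1 - y t)) / n) atBot (𝓝 (1 + (k + 1) / n)) := by
    have : (1 + (k + 1) / n) = (k + (n + 1) * (1 - 0)) / n := by field_simp; ring
    rw [this]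
    exact ((tendsto_const_nhds.add ((tendsto_const_nhds.sub hy).const_mul _))).div_const _
  have hW : Tendsto (fun t => (2 * n - (n + 1) * y t - (n - 1) * Real.exp (w t)) / n) atBot
      (𝓝 2) := by
    have : (2 * n - (n + 1) * 0 - (n - 1) * 0) / n = 2 := by field_simp; ring
    have hlim := ((tendsto_const_nhds (x := 2 * n)).sub (hy.const_mul (n + 1))).sub
      (hq.const_mul (n - 1)) |>.div_const n
    rwa [this] at hlim
  obtain ⟨a, ha⟩ := eventually_atBot.1
    ((hA.eventually (lt_mem_nhds (a := 1 + δ) (by linarith))).and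
      (hW.eventually (lt_mem_nhds (a := 7 / 4) (by norm_num))))
  -- K/4 bounds the coefficient of −q in y'. With the margin 1/4 in the rate of q, this makes (y +
  -- Kq)e^{−(1+δ)t} nondecreasing on (−∞, a].
  set K : ℝ := 4 * ((k + (n + 1)) / n) with hK
  have hK0 : 0 ≤ K := by positivity
  have hd : ∀ t, HasDerivAt (fun t => (y t + K * Real.exp (w t)) * Real.exp (-(1 + δ) * t))
      (((k + (n + 1) * (1 - y t)) / n * (y t - Real.exp (w t)) +
        K * (Real.exp (w t) * ((2 * n - (n + 1) * y t - (n - 1) * Real.exp (w t)) / n))) *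
          Real.exp (-(1 + δ) * t) +
        (y t + K * Real.exp (w t)) * (Real.exp (-(1 + δ) * t) * (-(1 + δ) * 1))) t := fun t =>
    ((h.hasDerivAt_y t).add (((h.hasDerivAt_w t).exp).const_mul K)).mul
      (((hasDerivAt_id t).const_mul (-(1 + δ))).exp)
  refine ⟨δ, (y a + K * Real.exp (w a)) * Real.exp (-(1 + δ) * a), a, hδ0, fun t ht => ?_⟩
  have hmono := mul_sub_le_of_le_deriv hd ht (δ := 0) fun s hs => by
    obtain ⟨h1, h2⟩ := ha s hs.2
    have h3 : (k + (n + 1) * (1 - y s)) / n ≤ (k + (n + 1)) / n := by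
      gcongr
      nlinarith [h.y_pos s]
    set A := (k + (n + 1) * (1 - y s)) / n
    set W := (2 * n - (n + 1) * y s - (n - 1) * Real.exp (w s)) / n
    have hq0 := Real.exp_pos (w s)
    have hy0 := h.y_pos s
    have h4 : 0 ≤ (A - (1 + δ)) * y s := mul_nonneg (by linarith) hy0.le
    have h5 : K * (1 / 4) ≤ K * (W - (1 + δ)) := mul_le_mul_of_nonneg_left (by linarith) hK0
    have h6 : 0 ≤ Real.exp (w s) * (K * (W - (1 + δ)) - A) :=
      mul_nonneg hq0.le (by linarith)
    have h7 : 0 ≤ ((A - (1 + δ)) * y s + Real.exp (w s) * (K * (W - (1 + δ)) - A)) *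
        Real.exp (-(1 + δ) * s) := mul_nonneg (add_nonneg h4 h6) (Real.exp_pos _).le
    linarith
  rw [zero_mul, sub_nonneg] at hmono
  have hexp : Real.exp (-(1 + δ) * t) * Real.exp ((1 + δ) * t) = 1 := by
    rw [← Real.exp_add, ← Real.exp_zero]; congr 1; ring
  calc y t ≤ y t + K * Real.exp (w t) := by
        linarith [mul_nonneg hK0 (Real.exp_pos (w t)).le]
    _ = (y t + K * Real.exp (w t)) * Real.exp (-(1 + δ) * t) * Real.exp ((1 + δ) * t) := by
        rw [mul_assoc (y t + K * _), hexp, mul_one]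
    _ ≤ _ := mul_le_mul_of_nonneg_right hmono (Real.exp_pos _).le

theorem hasDerivAt_w_sub (h : IsOrbit n k y w) (hn : 0 < n) (t : ℝ) :
    HasDerivAt (fun t => w t - 2 * t) (-((n + 1) * y t + (n - 1) * Real.exp (w t)) / n) t := by
  refine ((h.hasDerivAt_w t).sub ((hasDerivAt_id t).const_mul 2)).congr_deriv ?_
  field_simp
  ring

/-- The derivative of w − 2t is O(y), since q ≤ y, hence integrable at −∞ by the exponential bound.
-/
theorem exists_tendsto_w_sub (h : IsOrbit n k y w) (hn : 0 < n) (hk : 0 < k) :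
    ∃ l, Tendsto (fun t => w t - 2 * t) atBot (𝓝 l) := by
  obtain ⟨δ, C, a, hδ, hC⟩ := h.exists_y_le_exp hn hk
  refine ⟨_, MeasureTheory.tendsto_limUnder_of_hasDerivAt_of_integrableOn_Iic (a := a)
    (fun t _ => h.hasDerivAt_w_sub hn t) ?_⟩
  have hint : MeasureTheory.IntegrableOn
      (fun t => (n + 1 + |n - 1|) / n * (C * Real.exp ((1 + δ) * t))) (Iic a) :=
    ((integrableOn_exp_mul_Iic (by linarith : 0 < 1 + δ) a).const_mul C).const_mul _
  refine hint.mono' ?_ ?_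
  · have := h.continuous_y
    have := h.continuous_w
    exact Continuous.aestronglyMeasurable (by fun_prop)
  · refine (MeasureTheory.ae_restrict_iff' measurableSet_Iic).2 (Eventually.of_forall fun t ht => ?_)
    have hy0 := h.y_pos t
    have hq0 := Real.exp_pos (w t)
    rw [norm_div, norm_neg, Real.norm_of_nonneg hn.le, div_mul_eq_mul_div]
    gcongr
    calc ‖(n + 1) * y t + (n - 1) * Real.exp (w t)‖
        ≤ ‖(n + 1) * y t‖ + ‖(n - 1) * Real.exp (w t)‖ := norm_add_le _ _
      _ = (n + 1) * y t + |n - 1| * Real.exp (w t) := by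
        rw [Real.norm_of_nonneg (by positivity), norm_mul, Real.norm_eq_abs, Real.norm_eq_abs,
          abs_of_pos hq0]
      _ ≤ (n + 1) * y t + |n - 1| * y t := by gcongr; exact h.exp_le t
      _ = (n + 1 + |n - 1|) * y t := by ring
      _ ≤ _ := by gcongr; exact hC t ht

end IsOrbit

theorem IsOrbit.tendsto_y_mul_exp_neg {n k : ℝ} {y w : ℝ → ℝ} (h : IsOrbit n k y w) (hn : 0 < n)
    (hk : 0 < k) : Tendsto (fun t => y t * Real.exp (-t)) atBot (𝓝 0) := by
  obtain ⟨δ, C, a, hδ, hC⟩ := h.exists_y_le_exp hn hk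
  have hlim : Tendsto (fun t : ℝ => C * Real.exp (δ * t)) atBot (𝓝 0) := by
    simpa using (Real.tendsto_exp_atBot.comp (tendsto_id.const_mul_atBot hδ)).const_mul C
  refine tendsto_of_tendsto_of_tendsto_of_le_of_le' tendsto_const_nhds hlim
    (Eventually.of_forall fun t => mul_nonneg (h.y_pos t).le (Real.exp_pos _).le) ?_
  filter_upwards [eventually_le_atBot a] with t ht
  refine (mul_le_mul_of_nonneg_right (hC t ht) (Real.exp_pos (-t)).le).trans_eq ?_
  rw [mul_assoc, ← Real.exp_add]
  congr 2
  ring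

/-! ### Recovering Σ and U in logarithmic variables -/

/-- The solution in logarithmic variables: `S = log Σ` and `V = log U` as functions of `log ξ`. -/
structure IsLogSolution (n k c Sig₀ : ℝ) (S V W : ℝ → ℝ) : Prop where
  hasDerivAt_S : ∀ s, HasDerivAt S (Real.exp (V s - S s + 2 * s)) s
  hasDerivAt_V : ∀ s, HasDerivAt V (W s) s
  eq_W : ∀ s, n * W s = k * (Real.exp (S s + V s) - c) + Real.exp (V s - S s + 2 * s)
  continuous_W : Continuous W
  tendsto_S_atBot : Tendsto S atBot (𝓝 (Real.log Sig₀))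
  tendsto_V_atBot : Tendsto V atBot (𝓝 (Real.log (c / Sig₀)))
  tendsto_W_atBot : Tendsto (fun s => W s * Real.exp (-s)) atBot (𝓝 0)
  tendsto_S_atTop : Tendsto (fun s => S s - s) atTop (𝓝 0)
  tendsto_V_atTop : Tendsto (fun s => V s + s) atTop (𝓝 0)

/-- Inverts log P = S + V and log q = V − S + 2s along the orbit evaluated at time s + τ. -/
theorem exists_isLogSolution {n k c Sig₀ : ℝ} (hn : 0 < n) (hk : 0 < k) (hc : c = 1 + (n + 1) / k)
    (hSig₀ : 0 < Sig₀) : ∃ S V W : ℝ → ℝ, IsLogSolution n k c Sig₀ S V W := by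
  obtain ⟨y, w, h⟩ := exists_isOrbit hn hk
  obtain ⟨l, hl⟩ := h.exists_tendsto_w_sub hn hk
  have hc0 : 0 < c := by rw [hc]; positivity
  -- The shift solving log c/2 − l/2 − τ = log Σ₀, the required limit of S.
  set τ : ℝ := Real.log c / 2 - l / 2 - Real.log Sig₀ with hτ
  set P : ℝ → ℝ := fun t => c - (n + 1) / k * y t with hP
  have hkP : ∀ t, k * P t = k + (n + 1) * (1 - y t) := fun t => by
    simp only [hP, hc]; field_simp; ring
  have hP0 : ∀ t, 0 < P t := fun t => by
    have h1 : 0 < k * P t := by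
      rw [hkP]
      have : 0 ≤ (n + 1) * (1 - y t) := mul_nonneg (by linarith) (by linarith [h.le_one t])
      linarith
    exact pos_of_mul_pos_right h1 hk.le
  have hdP : ∀ t, HasDerivAt (fun t => Real.log (P t))
      (-((n + 1) * (y t - Real.exp (w t))) / n) t := fun t => by
    refine ((((h.hasDerivAt_y t).const_mul ((n + 1) / k)).const_sub c).log (hP0 t).ne').congr_deriv ?_
    change -((n + 1) / k * ((k + (n + 1) * (1 - y t)) / n * (y t - Real.exp (w t)))) / P t = _
    have := (hP0 t).ne'
    rw [← hkP]
    field_simp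
  have hlogbot : Tendsto (fun t => Real.log (P t)) atBot (𝓝 (Real.log c)) := by
    have h1 : Tendsto P atBot (𝓝 (c - (n + 1) / k * 0)) :=
      tendsto_const_nhds.sub ((h.tendsto_y_atBot hn hk).const_mul _)
    rw [mul_zero, sub_zero] at h1
    exact h1.log hc0.ne'
  have hlogtop : Tendsto (fun t => Real.log (P t)) atTop (𝓝 0) := by
    have h1 : Tendsto P atTop (𝓝 (c - (n + 1) / k * 1)) :=
      tendsto_const_nhds.sub ((h.tendsto_y_atTop hn hk).const_mul _)
    rw [mul_one, hc, add_sub_cancel_right] at h1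
    simpa using h1.log one_ne_zero
  have hshift : ∀ s, HasDerivAt (fun s => s + τ) 1 s := fun s => (hasDerivAt_id s).add_const τ
  have hbot : Tendsto (fun s => s + τ) atBot atBot := tendsto_atBot_add_const_right _ _ tendsto_id
  have htop : Tendsto (fun s => s + τ) atTop atTop := tendsto_atTop_add_const_right _ _ tendsto_id
  have hlog' : ∀ s, HasDerivAt (fun s => Real.log (P (s + τ)))
      (-((n + 1) * (y (s + τ) - Real.exp (w (s + τ)))) / n) s := fun s => by
    simpa [Function.comp_def] using (hdP (s + τ)).comp s (hshift s)
  have hw' : ∀ s, HasDerivAt (fun s => w (s + τ) - 2 * (s + τ))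
      (-((n + 1) * y (s + τ) + (n - 1) * Real.exp (w (s + τ))) / n) s := fun s => by
    simpa [Function.comp_def] using (h.hasDerivAt_w_sub hn (s + τ)).comp s (hshift s)
  have hwbot := hl.comp hbot
  have hPbot := hlogbot.comp hbot
  have hPtop := hlogtop.comp htop
  have hwtop := (h.tendsto_w_atTop hn hk).comp htop
  have hlogdiv : Real.log (c / Sig₀) = Real.log c - Real.log Sig₀ :=
    Real.log_div hc0.ne' hSig₀.ne'
  refine ⟨fun s => Real.log (P (s + τ)) / 2 - (w (s + τ) - 2 * (s + τ)) / 2 - τ,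
    fun s => Real.log (P (s + τ)) / 2 + (w (s + τ) - 2 * (s + τ)) / 2 + τ,
    fun s => (Real.exp (w (s + τ)) - (n + 1) * y (s + τ)) / n, ?_, ?_, ?_, ?_, ?_, ?_, ?_, ?_, ?_⟩
  · intro s
    refine ((((hlog' s).div_const 2).sub ((hw' s).div_const 2)).sub_const τ).congr_deriv ?_
    rw [show Real.log (P (s + τ)) / 2 + (w (s + τ) - 2 * (s + τ)) / 2 + τ -
        (Real.log (P (s + τ)) / 2 - (w (s + τ) - 2 * (s + τ)) / 2 - τ) + 2 * s = w (s + τ) by ring]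
    field_simp
    ring
  · intro s
    refine ((((hlog' s).div_const 2).add ((hw' s).div_const 2)).add_const τ).congr_deriv ?_
    field_simp
    ring
  · intro s
    have h1 : Real.log (P (s + τ)) / 2 - (w (s + τ) - 2 * (s + τ)) / 2 - τ +
        (Real.log (P (s + τ)) / 2 + (w (s + τ) - 2 * (s + τ)) / 2 + τ) = Real.log (P (s + τ)) := by
      ring
    have h2 : Real.log (P (s + τ)) / 2 + (w (s + τ) - 2 * (s + τ)) / 2 + τ -
        (Real.log (P (s + τ)) / 2 - (w (s + τ) - 2 * (s + τ)) / 2 - τ) + 2 * s = w (s + τ) := by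
      ring
    simp only [h1, h2, Real.exp_log (hP0 _), mul_sub, hkP]
    rw [hc]
    field_simp
    ring
  · have := h.continuous_y
    have := h.continuous_w
    fun_prop
  · rw [show Real.log Sig₀ = Real.log c / 2 - l / 2 - τ by rw [hτ]; ring]
    exact ((hPbot.div_const 2).sub (hwbot.div_const 2)).sub_const τ
  · rw [show Real.log (c / Sig₀) = Real.log c / 2 + l / 2 + τ by rw [hlogdiv, hτ]; ring]
    exact ((hPbot.div_const 2).add (hwbot.div_const 2)).add_const τ
  -- W is a combination of q and y, and 0 < q ≤ y = o(e^t).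
  · have hy := (h.tendsto_y_mul_exp_neg hn hk).comp hbot
    have hq : Tendsto (fun t => Real.exp (w t) * Real.exp (-t)) atBot (𝓝 0) :=
      squeeze_zero (fun t => by positivity)
        (fun t => mul_le_mul_of_nonneg_right (h.exp_le t) (Real.exp_pos _).le)
        (h.tendsto_y_mul_exp_neg hn hk)
    have hlim := ((((hq.comp hbot).sub (hy.const_mul (n + 1))).div_const n).mul_const (Real.exp τ))
    simp only [mul_zero, sub_zero, zero_div, zero_mul] at hlim
    refine hlim.congr fun s => ?_
    have : Real.exp (-s) = Real.exp (-(s + τ)) * Real.exp τ := by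
      rw [← Real.exp_add]; congr 1; ring
    simp only [Function.comp_apply, this]
    ring
  · have hlim := (hPtop.div_const 2).sub (hwtop.div_const 2)
    simp only [zero_div, sub_zero] at hlim
    refine hlim.congr fun s => ?_
    simp only [Function.comp_apply]
    ring
  · have hlim := (hPtop.div_const 2).add (hwtop.div_const 2)
    simp only [zero_div, add_zero] at hlim
    refine hlim.congr fun s => ?_
    simp only [Function.comp_apply]
    ring

/-! ### One-sided calculus at the origin -/

/-- One-sided differentiability at the origin from the limit of the derivative. -/
theorem hasDerivWithinAt_Ici_of_tendsto {f f' : ℝ → ℝ} (hf : ∀ x, 0 < x → HasDerivAt f (f' x) x)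
    (h0 : Tendsto f (𝓝[>] 0) (𝓝 (f 0))) (h0' : Tendsto f' (𝓝[>] 0) (𝓝 (f' 0))) {x : ℝ}
    (hx : 0 ≤ x) : HasDerivWithinAt f (f' x) (Ici 0) x := by
  rcases hx.eq_or_lt with rfl | hx
  · refine hasDerivWithinAt_Ici_of_tendsto_deriv (s := Ioi 0)
      (fun x hx => (hf x hx).differentiableAt.differentiableWithinAt) h0 self_mem_nhdsWithin ?_
    refine h0'.congr' ?_
    filter_upwards [self_mem_nhdsWithin] with x hx
    exact (hf x hx).deriv.symm
  · exact (hf x hx).hasDerivWithinAt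

theorem contDiffOn_one_of_hasDerivWithinAt {f f' : ℝ → ℝ} {s : Set ℝ} (hs : UniqueDiffOn ℝ s)
    (hf : ∀ x ∈ s, HasDerivWithinAt f (f' x) s x) (hf' : ContinuousOn f' s) :
    ContDiffOn ℝ 1 f s :=
  (contDiffOn_one_iff_derivWithin hs).2 ⟨fun x hx => (hf x hx).differentiableWithinAt,
    hf'.congr fun x hx => (hf x hx).derivWithin (hs x hx)⟩

theorem contDiffOn_two_of_hasDerivWithinAt {f f' : ℝ → ℝ} {s : Set ℝ} (hs : UniqueDiffOn ℝ s)
    (hf : ∀ x ∈ s, HasDerivWithinAt f (f' x) s x) (hf' : ContDiffOn ℝ 1 f' s) :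
    ContDiffOn ℝ 2 f s := by
  rw [show (2 : WithTop ℕ∞) = 1 + 1 by norm_num, contDiffOn_succ_iff_derivWithin hs]
  exact ⟨fun x hx => (hf x hx).differentiableWithinAt, by simp,
    hf'.congr fun x hx => (hf x hx).derivWithin (hs x hx)⟩

theorem isLittleO_sub_of_hasDerivWithinAt_zero {f : ℝ → ℝ}
    (hf : HasDerivWithinAt f 0 (Ici 0) 0) :
    (fun x => f x - f 0) =o[𝓝[>] 0] (fun x : ℝ => x) := by
  have := (hasDerivWithinAt_iff_isLittleO.1 hf).mono (nhdsWithin_mono 0 Ioi_subset_Ici_self)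
  simpa using this

/-- If `f' = x g` and `g = g 0 + o(1)`, then `f` has a quadratic Taylor expansion at the origin. -/
theorem isLittleO_quadratic {f g : ℝ → ℝ}
    (hf : ∀ x ∈ Ici (0 : ℝ), HasDerivWithinAt f (x * g x) (Ici 0) x)
    (hg : Tendsto g (𝓝[>] 0) (𝓝 (g 0))) :
    (fun x => f x - (f 0 + 1 / 2 * g 0 * x ^ 2)) =o[𝓝[>] 0] (fun x : ℝ => x ^ 2) := by
  refine isLittleO_iff.2 fun ε hε => ?_
  obtain ⟨r, hr, hball⟩ := mem_nhdsGT_iff_exists_Ioo_subset.1 (Metric.tendsto_nhds.1 hg ε hε)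
  have hr0 : (0 : ℝ) < r := hr
  filter_upwards [Ioo_mem_nhdsGT hr0] with x hx
  have hd : ∀ z ∈ Icc 0 x, HasDerivWithinAt (fun z => f z - (f 0 + 1 / 2 * g 0 * z ^ 2))
      (z * (g z - g 0)) (Icc 0 x) z := fun z hz => by
    have h1 := ((((hasDerivAt_id z).pow 2).const_mul (1 / 2 * g 0)).const_add
      (f 0)).hasDerivWithinAt (s := Icc 0 x)
    refine (((hf z hz.1).mono Icc_subset_Ici_self).sub h1).congr_deriv ?_
    simp only [id]
    push_cast
    ring
  -- On [0, x] the remainder has derivative z(g z − g 0), of size at most εx, so it is at most εx²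
  -- at x.
  have hmv := norm_image_sub_le_of_norm_deriv_le_segment' (C := ε * x) hd (fun z hz => by
    rw [norm_mul, Real.norm_of_nonneg hz.1, mul_comm]
    refine mul_le_mul ?_ hz.2.le hz.1 hε.le
    rcases hz.1.eq_or_lt with rfl | hz0
    · simpa using hε.le
    · exact (hball ⟨hz0, hz.2.trans hx.2⟩).le) x ⟨hx.1.le, le_rfl⟩
  rw [norm_pow, Real.norm_of_nonneg hx.1.le]
  refine le_trans (le_of_eq ?_) (hmv.trans_eq (by ring))
  simp

/-! ### Return to the variable ξ -/

/-- The function `exp (S (log ξ))` on `ξ > 0`, extended by the value `a`. -/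
noncomputable def expLog (a : ℝ) (S : ℝ → ℝ) (ξ : ℝ) : ℝ :=
  if 0 < ξ then Real.exp (S (Real.log ξ)) else a

theorem expLog_of_pos (a : ℝ) (S : ℝ → ℝ) {ξ : ℝ} (hξ : 0 < ξ) :
    expLog a S ξ = Real.exp (S (Real.log ξ)) := if_pos hξ

theorem expLog_zero (a : ℝ) (S : ℝ → ℝ) : expLog a S 0 = a := if_neg (lt_irrefl 0)

theorem expLog_pos {a : ℝ} (ha : 0 < a) (S : ℝ → ℝ) (ξ : ℝ) : 0 < expLog a S ξ := by
  unfold expLog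
  split_ifs
  exacts [Real.exp_pos _, ha]

theorem log_expLog {a : ℝ} {S : ℝ → ℝ} {ξ : ℝ} (hξ : 0 < ξ) :
    Real.log (expLog a S ξ) = S (Real.log ξ) := by
  rw [expLog_of_pos _ _ hξ, Real.log_exp]

theorem hasDerivAt_expLog {a : ℝ} {S : ℝ → ℝ} {S' ξ : ℝ} (hξ : 0 < ξ)
    (hS : HasDerivAt S S' (Real.log ξ)) :
    HasDerivAt (expLog a S) (expLog a S ξ * (S' / ξ)) ξ := by
  have h1 := (hS.comp ξ (Real.hasDerivAt_log hξ.ne')).exp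
  rw [expLog_of_pos _ _ hξ, div_eq_mul_inv]
  refine h1.congr_of_eventuallyEq ?_
  filter_upwards [lt_mem_nhds hξ] with x hx
  exact expLog_of_pos _ _ hx

theorem tendsto_expLog_nhdsGT {a : ℝ} (ha : 0 < a) {S : ℝ → ℝ}
    (hS : Tendsto S atBot (𝓝 (Real.log a))) : Tendsto (expLog a S) (𝓝[>] 0) (𝓝 a) := by
  have h1 := (Real.continuous_exp.tendsto _).comp (hS.comp Real.tendsto_log_nhdsGT_zero)
  rw [Real.exp_log ha] at h1
  refine h1.congr' ?_
  filter_upwards [self_mem_nhdsWithin] with x hx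
  exact (expLog_of_pos _ _ hx).symm

/-- If `S(s) - m s → 0` at infinity, then `exp (S (log ξ)) / ξ ^ m → 1`. -/
theorem tendsto_expLog_mul_atTop {a m : ℝ} {S : ℝ → ℝ}
    (hS : Tendsto (fun s => S s - m * s) atTop (𝓝 0)) :
    Tendsto (fun ξ => expLog a S ξ * Real.exp (-(m * Real.log ξ))) atTop (𝓝 1) := by
  have h1 := (Real.continuous_exp.tendsto _).comp (hS.comp Real.tendsto_log_atTop)
  rw [Real.exp_zero] at h1
  refine h1.congr' ?_
  filter_upwards [eventually_gt_atTop 0] with x hx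
  rw [expLog_of_pos _ _ hx, ← Real.exp_add, Function.comp_apply, Function.comp_apply, sub_eq_add_neg]

theorem isLittleO_sub_of_tendsto_div_one {f g : ℝ → ℝ} {l : Filter ℝ} (hg : ∀ᶠ x in l, g x ≠ 0)
    (h : Tendsto (fun x => f x / g x) l (𝓝 1)) : (fun x => f x - g x) =o[l] g :=
  (isEquivalent_iff_tendsto_one hg).2 h

namespace IsLogSolution

variable {n k c Sig₀ : ℝ} {S V W : ℝ → ℝ}

/-- The derivative of `U = exp (V (log ξ))`, extended by zero. -/
noncomputable def derivU (c Sig₀ : ℝ) (V W : ℝ → ℝ) (ξ : ℝ) : ℝ :=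
  if 0 < ξ then expLog (c / Sig₀) V ξ * (W (Real.log ξ) / ξ) else 0

theorem hasDerivAt_Sig (h : IsLogSolution n k c Sig₀ S V W) {ξ : ℝ} (hξ : 0 < ξ) :
    HasDerivAt (expLog Sig₀ S) (ξ * expLog (c / Sig₀) V ξ) ξ := by
  refine (hasDerivAt_expLog hξ (h.hasDerivAt_S _)).congr_deriv ?_
  rw [expLog_of_pos _ _ hξ, expLog_of_pos _ _ hξ, ← mul_div_assoc, ← Real.exp_add,
    show S (Real.log ξ) + (V (Real.log ξ) - S (Real.log ξ) + 2 * Real.log ξ) =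
      V (Real.log ξ) + Real.log ξ + Real.log ξ by ring, Real.exp_add, Real.exp_add,
    Real.exp_log hξ]
  field_simp

theorem hasDerivAt_U (h : IsLogSolution n k c Sig₀ S V W) {ξ : ℝ} (hξ : 0 < ξ) :
    HasDerivAt (expLog (c / Sig₀) V) (derivU c Sig₀ V W ξ) ξ := by
  rw [derivU, if_pos hξ]
  exact hasDerivAt_expLog hξ (h.hasDerivAt_V _)

theorem tendsto_U (h : IsLogSolution n k c Sig₀ S V W) (hc : 0 < c) (hSig₀ : 0 < Sig₀) :
    Tendsto (expLog (c / Sig₀) V) (𝓝[>] 0) (𝓝 (c / Sig₀)) :=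
  tendsto_expLog_nhdsGT (div_pos hc hSig₀) h.tendsto_V_atBot

/-- U' = U·W/ξ, and W/ξ is W(s)e^{−s} at s = log ξ. -/
theorem tendsto_derivU (h : IsLogSolution n k c Sig₀ S V W) (hc : 0 < c) (hSig₀ : 0 < Sig₀) :
    Tendsto (derivU c Sig₀ V W) (𝓝[>] 0) (𝓝 0) := by
  have h1 := (h.tendsto_U hc hSig₀).mul (h.tendsto_W_atBot.comp Real.tendsto_log_nhdsGT_zero)
  rw [mul_zero] at h1
  refine h1.congr' ?_
  filter_upwards [self_mem_nhdsWithin] with x hx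
  have hx' : 0 < x := hx
  rw [derivU, if_pos hx', Function.comp_apply, Real.exp_neg, Real.exp_log hx', ← div_eq_mul_inv]

theorem continuousOn_derivU (h : IsLogSolution n k c Sig₀ S V W) (hc : 0 < c) (hSig₀ : 0 < Sig₀) :
    ContinuousOn (derivU c Sig₀ V W) (Ici 0) := by
  intro x hx
  rcases (mem_Ici.1 hx).eq_or_lt with rfl | hx
  · have h0 : derivU c Sig₀ V W 0 = 0 := if_neg (lt_irrefl 0)
    rw [← Ioi_insert, continuousWithinAt_insert_self, ContinuousWithinAt, h0]
    exact h.tendsto_derivU hc hSig₀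
  · have h1 : ContinuousAt (fun x => expLog (c / Sig₀) V x * (W (Real.log x) / x)) x :=
      (h.hasDerivAt_U hx).continuousAt.mul
        (((h.continuous_W.continuousAt).comp (Real.continuousAt_log hx.ne')).div continuousAt_id
          hx.ne')
    refine (h1.congr ?_).continuousWithinAt
    filter_upwards [lt_mem_nhds hx] with z hz
    exact (if_pos hz).symm

theorem hasDerivWithinAt_U (h : IsLogSolution n k c Sig₀ S V W) (hc : 0 < c) (hSig₀ : 0 < Sig₀)
    {ξ : ℝ} (hξ : ξ ∈ Ici (0 : ℝ)) :
    HasDerivWithinAt (expLog (c / Sig₀) V) (derivU c Sig₀ V W ξ) (Ici 0) ξ := by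
  refine hasDerivWithinAt_Ici_of_tendsto (fun x hx => h.hasDerivAt_U hx) ?_ ?_ hξ
  · rw [expLog_zero]
    exact h.tendsto_U hc hSig₀
  · rw [derivU, if_neg (lt_irrefl 0)]
    exact h.tendsto_derivU hc hSig₀

theorem hasDerivWithinAt_Sig (h : IsLogSolution n k c Sig₀ S V W) (hc : 0 < c) (hSig₀ : 0 < Sig₀)
    {ξ : ℝ} (hξ : ξ ∈ Ici (0 : ℝ)) :
    HasDerivWithinAt (expLog Sig₀ S) (ξ * expLog (c / Sig₀) V ξ) (Ici 0) ξ := by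
  refine hasDerivWithinAt_Ici_of_tendsto (f' := fun ξ => ξ * expLog (c / Sig₀) V ξ)
    (fun x hx => h.hasDerivAt_Sig hx) ?_ ?_ hξ
  · rw [expLog_zero]
    exact tendsto_expLog_nhdsGT hSig₀ h.tendsto_S_atBot
  · rw [expLog_zero]
    exact (tendsto_id.mono_left nhdsWithin_le_nhds).mul (h.tendsto_U hc hSig₀)

theorem contDiffOn_U (h : IsLogSolution n k c Sig₀ S V W) (hc : 0 < c) (hSig₀ : 0 < Sig₀) :
    ContDiffOn ℝ 1 (expLog (c / Sig₀) V) (Ici 0) :=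
  contDiffOn_one_of_hasDerivWithinAt (uniqueDiffOn_Ici 0)
    (fun _ hx => h.hasDerivWithinAt_U hc hSig₀ hx) (h.continuousOn_derivU hc hSig₀)

theorem contDiffOn_Sig (h : IsLogSolution n k c Sig₀ S V W) (hc : 0 < c) (hSig₀ : 0 < Sig₀) :
    ContDiffOn ℝ 2 (expLog Sig₀ S) (Ici 0) :=
  contDiffOn_two_of_hasDerivWithinAt (uniqueDiffOn_Ici 0)
    (fun _ hx => h.hasDerivWithinAt_Sig hc hSig₀ hx) (contDiffOn_id.mul (h.contDiffOn_U hc hSig₀))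

/-- Θ is defined by solving the algebraic equation; the equation for Θ' then reduces to `eq_W`, as
kc = k + n + 1. -/
theorem isSolution (h : IsLogSolution n k c Sig₀ S V W) {α ν : ℝ} (hn : 0 < n) (hα : 0 < α)
    (hν : 0 < ν) (hk : k = α / ν) (hc : c = 1 + (n + 1) / k) (hSig₀ : 0 < Sig₀) :
    IsSolution n α ν (expLog Sig₀ S) (expLog (c / Sig₀) V) (fun ξ =>
      -(1 / α) * Real.log (expLog Sig₀ S ξ) + n / α * Real.log (expLog (c / Sig₀) V ξ)) := by
  have hk0 : 0 < k := hk ▸ div_pos hα hν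
  have hc0 : 0 < c := by rw [hc]; positivity
  have hS := expLog_pos hSig₀ S
  have hU := expLog_pos (div_pos hc0 hSig₀) V
  have hTh : ∀ ξ, 0 < ξ → HasDerivAt (fun ξ =>
      -(1 / α) * Real.log (expLog Sig₀ S ξ) + n / α * Real.log (expLog (c / Sig₀) V ξ))
      (-(1 / α) * (ξ * expLog (c / Sig₀) V ξ / expLog Sig₀ S ξ) +
        n / α * (W (Real.log ξ) / ξ)) ξ := fun ξ hξ => by
    refine ((((h.hasDerivAt_Sig hξ).log (hS ξ).ne').const_mul _).add
      (((h.hasDerivAt_U hξ).log (hU ξ).ne').const_mul _)).congr_deriv ?_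
    rw [derivU, if_pos hξ, mul_div_cancel_left₀ _ (hU ξ).ne']
  refine ⟨fun ξ _ => hU ξ, fun ξ hξ => h.hasDerivAt_Sig hξ, fun ξ hξ => (hTh ξ hξ).differentiableAt,
    fun ξ hξ => ?_, fun ξ hξ => ?_⟩
  · rw [(hTh ξ hξ).deriv]
    have h1 := h.eq_W (Real.log ξ)
    have h2 : Real.exp (S (Real.log ξ) + V (Real.log ξ)) =
        expLog Sig₀ S ξ * expLog (c / Sig₀) V ξ := by
      rw [Real.exp_add, expLog_of_pos _ _ hξ, expLog_of_pos _ _ hξ]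
    have h3 : Real.exp (V (Real.log ξ) - S (Real.log ξ) + 2 * Real.log ξ) =
        ξ ^ 2 * expLog (c / Sig₀) V ξ / expLog Sig₀ S ξ := by
      rw [Real.exp_add, Real.exp_sub, expLog_of_pos _ _ hξ, expLog_of_pos _ _ hξ, two_mul,
        Real.exp_add, Real.exp_log hξ]
      ring
    rw [h2, h3] at h1
    have h4 : ν * ((n + 1) / α + ξ * (-(1 / α) * (ξ * expLog (c / Sig₀) V ξ / expLog Sig₀ S ξ) +
        n / α * (W (Real.log ξ) / ξ))) = ν / α * (n + 1 -
          ξ ^ 2 * expLog (c / Sig₀) V ξ / expLog Sig₀ S ξ + n * W (Real.log ξ)) := by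
      field_simp
      ring
    have h5 : ν / α * k = 1 := by rw [hk]; field_simp
    have h6 : k * c = k + (n + 1) := by rw [hc]; field_simp
    rw [h4, h1]
    linear_combination (expLog Sig₀ S ξ * expLog (c / Sig₀) V ξ - 1) * h5 - ν / α * h6
  · have h1 : -α * (-(1 / α) * Real.log (expLog Sig₀ S ξ) +
        n / α * Real.log (expLog (c / Sig₀) V ξ)) =
        Real.log (expLog Sig₀ S ξ) - Real.log (expLog (c / Sig₀) V ξ) * n := by
      field_simp
      ring
    rw [h1, Real.rpow_def_of_pos (hU ξ), ← Real.exp_add, sub_add_cancel, Real.exp_log (hS ξ)]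

end IsLogSolution

end ShearBand

/-! ### Assembly of the theorem -/

theorem mainTheorem2 (n α Sig₀ ν : ℝ) (hn : 0 < n) (hα : 0 < α) (hSig₀ : 0 < Sig₀) (hν : 0 < ν) :
    ∃ Sig U Th : ℝ → ℝ,
      ShearBand.IsSolution n α ν Sig U Th ∧ Sig 0 = Sig₀ ∧
      -- the initial data are attained
      (Tendsto Sig (𝓝[>] 0) (𝓝 Sig₀) ∧
        Tendsto U (𝓝[>] 0) (𝓝 (ShearBand.U₀ n α ν Sig₀)) ∧
        Tendsto Th (𝓝[>] 0) (𝓝 (ShearBand.Th₀ n α ν Sig₀))) ∧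
      -- behaviour at infinity
      ((fun ξ => U ξ - 1 / ξ) =o[atTop] (fun ξ : ℝ => 1 / ξ) ∧
        (fun ξ => Sig ξ - ξ) =o[atTop] (fun ξ : ℝ => ξ) ∧
        (fun ξ => Th ξ - (-((n + 1) / α) * Real.log ξ)) =o[atTop] (fun _ : ℝ => (1 : ℝ))) ∧
      -- regularity up to the origin
      (ContDiffOn ℝ 1 U (Ici 0) ∧ ContDiffOn ℝ 1 Th (Ici 0) ∧ ContDiffOn ℝ 2 Sig (Ici 0)) ∧
      -- vanishing derivatives at the origin
      (HasDerivWithinAt Sig 0 (Ici 0) 0 ∧ HasDerivWithinAt U 0 (Ici 0) 0 ∧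
        HasDerivWithinAt Th 0 (Ici 0) 0) ∧
      -- Taylor expansions at the origin
      ((fun ξ => U ξ - ShearBand.U₀ n α ν Sig₀) =o[𝓝[>] 0] (fun ξ : ℝ => ξ) ∧
        (fun ξ => Sig ξ - (Sig₀ + 1 / 2 * ShearBand.U₀ n α ν Sig₀ * ξ ^ 2)) =o[𝓝[>] 0]
          (fun ξ : ℝ => ξ ^ 2) ∧
        (fun ξ => Th ξ - ShearBand.Th₀ n α ν Sig₀) =o[𝓝[>] 0] (fun ξ : ℝ => ξ)) := by
  have hk0 : 0 < α / ν := div_pos hα hν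
  obtain ⟨c, hcc⟩ : ∃ c, c = ShearBand.cConst n α ν := ⟨_, rfl⟩
  have hc : c = 1 + (n + 1) / (α / ν) := by
    rw [hcc, ShearBand.cConst]; field_simp
  have hc0 : 0 < c := by rw [hc]; positivity
  have hU₀ : ShearBand.U₀ n α ν Sig₀ = c / Sig₀ := by rw [ShearBand.U₀, hcc]
  obtain ⟨S, V, W, h⟩ := ShearBand.exists_isLogSolution hn hk0 hc hSig₀
  have hTh₀ : -(1 / α) * Real.log Sig₀ + n / α * Real.log (c / Sig₀) =
      ShearBand.Th₀ n α ν Sig₀ := by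
    rw [ShearBand.Th₀, hU₀, ← hcc, Real.log_div hc0.ne' hSig₀.ne']
    field_simp
    ring
  have hUpos := ShearBand.expLog_pos (div_pos hc0 hSig₀) V
  have hSpos := ShearBand.expLog_pos hSig₀ S
  have hS0 := ShearBand.expLog_zero Sig₀ S
  have hU0 := ShearBand.expLog_zero (c / Sig₀) V
  have hSlim := ShearBand.tendsto_expLog_nhdsGT hSig₀ h.tendsto_S_atBot
  have hUlim := h.tendsto_U hc0 hSig₀
  have hSC := h.contDiffOn_Sig hc0 hSig₀
  have hUC := h.contDiffOn_U hc0 hSig₀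
  have hSd : HasDerivWithinAt (ShearBand.expLog Sig₀ S) 0 (Ici 0) 0 := by
    simpa using h.hasDerivWithinAt_Sig hc0 hSig₀ (mem_Ici.2 le_rfl)
  have hUd : HasDerivWithinAt (ShearBand.expLog (c / Sig₀) V) 0 (Ici 0) 0 := by
    simpa [ShearBand.IsLogSolution.derivU] using
      h.hasDerivWithinAt_U hc0 hSig₀ (mem_Ici.2 le_rfl)
  have hThd : HasDerivWithinAt (fun ξ => -(1 / α) * Real.log (ShearBand.expLog Sig₀ S ξ) +
      n / α * Real.log (ShearBand.expLog (c / Sig₀) V ξ)) 0 (Ici 0) 0 := by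
    refine (((hSd.log (hSpos 0).ne').const_mul (-(1 / α))).add
      ((hUd.log (hUpos 0).ne').const_mul (n / α))).congr_deriv ?_
    simp
  refine ⟨_, _, _, h.isSolution hn hα hν rfl hc hSig₀, hS0, ⟨hSlim, ?_, ?_⟩, ⟨?_, ?_, ?_⟩,
    ⟨hUC, ?_, hSC⟩, ⟨hSd, hUd, hThd⟩, ?_, ?_, ?_⟩
  · rw [hU₀]; exact hUlim
  · rw [← hTh₀]
    exact ((hSlim.log hSig₀.ne').const_mul _).add ((hUlim.log (div_pos hc0 hSig₀).ne').const_mul _)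
  · refine ShearBand.isLittleO_sub_of_tendsto_div_one ?_ ?_
    · filter_upwards [eventually_gt_atTop 0] with x hx
      positivity
    · refine (ShearBand.tendsto_expLog_mul_atTop (a := c / Sig₀) (m := -1)
        (by simpa using h.tendsto_V_atTop)).congr' ?_
      filter_upwards [eventually_gt_atTop 0] with x hx
      rw [neg_one_mul, neg_neg, Real.exp_log hx, one_div, div_inv_eq_mul]
  · refine ShearBand.isLittleO_sub_of_tendsto_div_one (g := fun ξ => ξ) ?_ ?_
    · filter_upwards [eventually_gt_atTop 0] with x hx
      exact hx.ne'
    · refine (ShearBand.tendsto_expLog_mul_atTop (a := Sig₀) (m := 1)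
        (by simpa using h.tendsto_S_atTop)).congr' ?_
      filter_upwards [eventually_gt_atTop 0] with x hx
      rw [one_mul, Real.exp_neg, Real.exp_log hx, div_eq_mul_inv]
  · rw [isLittleO_one_iff]
    -- Θ + ((n+1)/α)s equals −(S − s)/α + n(V + s)/α.
    have hlim := ((h.tendsto_S_atTop.const_mul (-(1 / α))).add
      (h.tendsto_V_atTop.const_mul (n / α))).comp Real.tendsto_log_atTop
    rw [mul_zero, mul_zero, add_zero] at hlim
    refine hlim.congr' ?_
    filter_upwards [eventually_gt_atTop 0] with x hx
    rw [ShearBand.log_expLog hx, ShearBand.log_expLog hx, Function.comp_apply]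
    ring
  · exact (contDiffOn_const.mul ((hSC.of_le (by norm_num)).log fun x _ => (hSpos x).ne')).add
      (contDiffOn_const.mul (hUC.log fun x _ => (hUpos x).ne'))
  · have hV := ShearBand.isLittleO_sub_of_hasDerivWithinAt_zero hUd
    rw [hU₀]
    rwa [hU0] at hV
  · have hq := ShearBand.isLittleO_quadratic (fun x hx => h.hasDerivWithinAt_Sig hc0 hSig₀ hx)
      (by rw [hU0]; exact hUlim)
    rwa [hS0, hU0, ← hU₀] at hq
  · have hT := ShearBand.isLittleO_sub_of_hasDerivWithinAt_zero hThd
    rwa [hS0, hU0, hTh₀] at hT
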